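/- Let $H$ be a Hausdorff locally compact abelian group with Haar measure $\mathrm{vol}$ (written $du$ in integrals), and let $\tilde L\subset\mathbb R^d\times H$ be a lattice (a discrete, co-compact subgroup) such that the projection $\pi_1:\tilde L\to\mathbb R^d$ is injective and the projection of $\tilde L$ to $H$ has dense image. For $x\in L:=\pi_1(\tilde L)$ let $x^*\in H$ be the unique element with $(x,x^*)\in\tilde L$. Let $\Omega\subset H$ be a relatively compact set with non-empty interior and $\mathrm{vol}(\partial\Omega)=0$, and let $\Lambda=\Lambda(\Omega)=\{x\in L : x^*\in\Omega\}$ be the corresponding regular model set. For $s>0$ put $\Lambda_s=\Lambda\cap B_s(0)$, where $B_s(0)$ is the open Euclidean ball, and write $\Lambda-\Lambda=\{x_1-x_2 : x_1,x_2\in\Lambda\}$. Then $0<\mathrm{vol}(\Omega)<\infty$, every $\Lambda_s$ is finite, and the following hold. (1) For every $y\in\Lambda-\Lambda$ the autocorrelation coefficient per point $$\nu(y)=\lim_{s\to\infty}\frac{1}{|\Lambda_s|}\,\bigl|\{x\in\Lambda_s : x+y\in\Lambda\}\bigr|$$ exists, and $$\nu(y)=\lim_{s\to\infty}\frac{\bigl|\{x^*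 : x\in\Lambda_s,\ (x+y)^*\in\Omega\}\bigr|}{\bigl|\{x^* : x\in\Lambda_s\}\bigr|}=\frac{1}{\mathrm{vol}(\Omega)}\int_H\chi_\Omega(u)\,\chi_\Omega(u+y^*)\,du ,$$ where $\chi_\Omega$ is the characteristic function of $\Omega$; the second limit exists and the integrand is integrable. (2) For every real $r$ the set $\{y\in\Lambda-\Lambda : |y|=r\}$ is finite, and the averaged shelling number $$\sigma(r)=\lim_{s\to\infty}\frac{1}{|\Lambda_s|}\sum_{x\in\Lambda_s}\bigl|\{z\in\Lambda : |z-x|=r\}\bigr|$$ exists and equals $$\sigma(r)=\sum_{\substack{y\in\Lambda-\Lambda\\ |y|=r}}\nu(y).$$ -/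

import Mathlib

open Filter Topology MeasureTheory
open scoped Pointwise

/-- A cut and project scheme with physical space `ℝ^d` and internal space a Hausdorff locally
compact abelian group `H`: a lattice (discrete, co-compact subgroup) of `ℝ^d × H` that projects
injectively to physical space and densely to internal space. -/
structure CutAndProjectScheme (d : ℕ) (H : Type*) [AddCommGroup H] [TopologicalSpace H]
    [IsTopologicalAddGroup H] [LocallyCompactSpace H] [T2Space H] where
  /-- The lattice in the embedding space. -/
  lattice : AddSubgroup (EuclideanSpace ℝ (Fin d) × H)
  discrete : DiscreteTopology lattice
  cocompact : CompactSpace ((EuclideanSpace ℝ (Fin d) × H) ⧸ lattice)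
  injOn_fst : Set.InjOn Prod.fst (lattice : Set (EuclideanSpace ℝ (Fin d) × H))
  dense_snd : Dense (Prod.snd '' (lattice : Set (EuclideanSpace ℝ (Fin d) × H)))

namespace CutAndProjectScheme

variable {d : ℕ} {H : Type*} [AddCommGroup H] [TopologicalSpace H]
  [IsTopologicalAddGroup H] [LocallyCompactSpace H] [T2Space H]

/-- The projection of the lattice to physical space. -/
def physicalModule (S : CutAndProjectScheme d H) : AddSubgroup (EuclideanSpace ℝ (Fin d)) :=
  S.lattice.map (AddMonoidHom.fst (EuclideanSpace ℝ (Fin d)) H)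

open Classical in
/-- The `*`-map: for `x` in the projection of the lattice, `x*` is the unique element of the
internal space with `(x, x*)` in the lattice (and `0` for all other `x`, where it is not used). -/
noncomputable def starMap (S : CutAndProjectScheme d H) (x : EuclideanSpace ℝ (Fin d)) : H :=
  if h : ∃ u : H, (x, u) ∈ S.lattice then h.choose else 0

theorem starMap_eq (S : CutAndProjectScheme d H) {x : EuclideanSpace ℝ (Fin d)} {u : H}
    (hu : (x, u) ∈ S.lattice) : S.starMap x = u := by
  have h : ∃ u : H, (x, u) ∈ S.lattice := ⟨u, hu⟩
  have h1 : (x, S.starMap x) ∈ S.lattice := by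
    rw [starMap, dif_pos h]
    exact h.choose_spec
  exact congrArg Prod.snd (S.injOn_fst h1 hu rfl)

/-- The set `Λ(Ω)` of all points `x` of the projected lattice with `x* ∈ Ω`. -/
def modelSet (S : CutAndProjectScheme d H) (Ω : Set H) : Set (EuclideanSpace ℝ (Fin d)) :=
  {x | x ∈ S.physicalModule ∧ S.starMap x ∈ Ω}

end CutAndProjectScheme

/-- The windows of regular model sets: relatively compact, with non-empty interior, and with
boundary of Haar measure zero. -/
structure IsRegularWindow {H : Type*} [TopologicalSpace H] [MeasurableSpace H]
    (μ : Measure H) (Ω : Set H) : Prop where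
  isCompact_closure : IsCompact (closure Ω)
  nonempty_interior : (interior Ω).Nonempty
  measure_frontier : μ (frontier Ω) = 0

/-- `Λ_s = Λ ∩ B_s(0)`. -/
def ballPart {E : Type*} [SeminormedAddCommGroup E] (Λ : Set E) (s : ℝ) : Set E :=
  Λ ∩ Metric.ball 0 s

/-- The mean, over all centres `x ∈ Λ_s`, of the number of points of `Λ` at distance `r`
from `x`. -/
noncomputable def shellingAverage {E : Type*} [SeminormedAddCommGroup E] (Λ : Set E)
    (r s : ℝ) : ℝ :=
  (1 / ((ballPart Λ s).ncard : ℝ)) *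
    ∑ᶠ x ∈ ballPart Λ s, (({z | z ∈ Λ ∧ dist x z = r} : Set E).ncard : ℝ)

/-- The averaged shelling number of `Λ` at radius `r` exists and equals `σ`. -/
def HasAveragedShelling {E : Type*} [SeminormedAddCommGroup E] (Λ : Set E) (r σ : ℝ) : Prop :=
  Tendsto (shellingAverage Λ r) atTop (𝓝 σ)

/-- The autocorrelation coefficient of `Λ` at `y`, normalized per point, exists and equals `c`. -/
def HasAutocorrelation {E : Type*} [SeminormedAddCommGroup E] (Λ : Set E) (y : E) (c : ℝ) :
    Prop :=
  Tendsto (fun s : ℝ => (({x | x ∈ ballPart Λ s ∧ x + y ∈ Λ} : Set E).ncard : ℝ) /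
    ((ballPart Λ s).ncard : ℝ)) atTop (𝓝 c)

/-- The same coefficient computed in internal space: among the points of `(Λ_s)*`, the limiting
proportion of those `x*` with `(x + y)* ∈ Ω` exists and equals `c`. -/
def HasInternalAutocorrelation {d : ℕ} {H : Type*} [AddCommGroup H] [TopologicalSpace H]
    [IsTopologicalAddGroup H] [LocallyCompactSpace H] [T2Space H]
    (S : CutAndProjectScheme d H) (Ω : Set H) (y : EuclideanSpace ℝ (Fin d)) (c : ℝ) : Prop :=
  Tendsto (fun s : ℝ =>
    ((S.starMap '' {x | x ∈ ballPart (S.modelSet Ω) s ∧ S.starMap (x + y) ∈ Ω}).ncard : ℝ) /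
      ((S.starMap '' ballPart (S.modelSet Ω) s).ncard : ℝ)) atTop (𝓝 c)

/-- The integrand `χ_Ω(u) χ_Ω(u + v)` on internal space. -/
noncomputable def overlapIntegrand {H : Type*} [AddCommGroup H] (Ω : Set H) (v u : H) : ℝ :=
  Ω.indicator (fun _ => (1 : ℝ)) u * Ω.indicator (fun _ => (1 : ℝ)) (u + v)

/-- The normalized overlap `(1 / vol Ω) ∫ χ_Ω(u) χ_Ω(u + v) du` of a window and its translate. -/
noncomputable def windowOverlap {H : Type*} [AddCommGroup H] [MeasurableSpace H]
    (μ : Measure H) (Ω : Set H) (v : H) : ℝ :=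
  (1 / μ.real Ω) * ∫ u, overlapIntegrand Ω v u ∂μ

/-!
Write `p` and `q` for the projections of the lattice to physical and to internal space. All the
quantities in question count lattice points `γ` with `‖p γ‖ < s` and `q γ` in a window: the points
`x ∈ Λ_s` with `x + y ∈ Λ` are those with window `Ω ∩ (Ω - y*)`. Everything rests on the
equidistribution of `q γ`: as `s → ∞`, the number of points over a relatively compact window with
null boundary is asymptotically proportional to its Haar measure
(`IsCutProject.tendsto_ncard_div_ncard`).

For equidistribution, the sums of `f (q γ)` over `‖p γ‖ < s` are studied for continuous `f` of
compact support. Comparing volumes in physical space shows that the number of lattice points over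
an open window grows at least like `s ^ n`, whereas a shell of fixed width contributes `o(s ^ n)`
(`IsCutProject.exists_le_ncard_ball`, `IsCutProject.tendsto_ncard_annulus`). Hence the sums are
asymptotically invariant under translation by elements of the dense subgroup of all `q γ`, and by
uniform continuity under all translations (`IsCutProject.tendsto_ballSum_translate_sub`). The
argument that proves uniqueness of Haar measure, integrating the translates of one function against
another one and exchanging sum and integral, then gives proportionality to the Haar integral
(`IsCutProject.tendsto_ballSum_mul_integral_sub`). Indicator functions of windows are squeezed
between continuous functions, using regularity of a Haar measure.

The coefficient computed in internal space counts distinct values `x*`, and the `*`-map need not be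
injective. The periods, that is the `x` with `x* = 0`, are divided out by projecting physical space
to the orthogonal complement of their span. The result is again a configuration for which the
theorem above holds, with injective projection to internal space, and balls correspond to balls up
to a shell of bounded width (`IsCutProject.tendsto_ncard_image_div_ncard_image`).

The averaged shelling number is the sum of the autocorrelation coefficients over the finitely many
differences of length `r`, by double counting (`shellingAverage_eq_sum`).
-/

/-! ### Counting lattice points by volume -/

section Counting

open Metric Module

theorem isCompact_sub {G : Type*} [AddGroup G] [TopologicalSpace G] [IsTopologicalAddGroup G]
    {K L : Set G} (hK : IsCompact K) (hL : IsCompact L) : IsCompact (K - L) := by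
  rw [← Set.sub_image_prod]
  exact (hK.prod hL).image continuous_sub

variable {ι E H : Type*} [AddCommGroup ι] [NormedAddCommGroup E]
  [AddCommGroup H] [TopologicalSpace H]

/-- A pair of homomorphisms from a group `ι` to physical space `E` and to internal space `H` which
has the properties of the two projections of a lattice in `E × H` that govern counting: only
finitely many elements lie over a bounded set times a compact set, the elements over some fixed
compact set of `H` are relatively dense in `E`, and the image in `H` is dense. Neither homomorphism
is assumed to be injective. -/
structure IsCutProject (p : ι →+ E) (q : ι →+ H) : Prop where
  finite_slab : ∀ (R : ℝ) {K : Set H}, IsCompact K → {γ | ‖p γ‖ ≤ R ∧ q γ ∈ K}.Finite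
  exists_near : ∃ (R : ℝ) (K : Set H), IsCompact K ∧ ∀ e : E, ∃ γ, dist (p γ) e ≤ R ∧ q γ ∈ K
  denseRange : DenseRange q

variable {p : ι →+ E} {q : ι →+ H}

theorem IsCutProject.finite_ball (h : IsCutProject p q) {K : Set H} (hK : IsCompact K) (s : ℝ) :
    {γ | ‖p γ‖ < s ∧ q γ ∈ K}.Finite :=
  (h.finite_slab s hK).subset fun _ hγ => ⟨hγ.1.le, hγ.2⟩

variable [IsTopologicalAddGroup H]

/-- The elements over a non-empty open `U` are relatively dense: an element over the compact set of
`exists_near` is moved over `U` by one of finitely many elements, since the image in `H` is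
dense. -/
theorem IsCutProject.exists_relativelyDense (h : IsCutProject p q) {U : Set H} (hU : IsOpen U)
    (hne : U.Nonempty) : ∃ R : ℝ, 0 < R ∧ ∀ e : E, ∃ γ, dist (p γ) e < R ∧ q γ ∈ U := by
  obtain ⟨R, K, hK, hnear⟩ := h.exists_near
  have hcov : K ⊆ ⋃ τ : ι, (fun u => u + q τ) ⁻¹' U := by
    intro u _
    have hV : IsOpen ((fun w => u + w) ⁻¹' U) := hU.preimage (by fun_prop)
    obtain ⟨v, hv⟩ := hne
    obtain ⟨τ, hτ⟩ := h.denseRange.exists_mem_open hV ⟨-u + v, by simpa using hv⟩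
    exact Set.mem_iUnion.2 ⟨τ, hτ⟩
  obtain ⟨F, hF⟩ := hK.elim_finite_subcover _ (fun τ => hU.preimage (by fun_prop)) hcov
  refine ⟨max R 0 + ∑ τ ∈ F, ‖p τ‖ + 1, by positivity, fun e => ?_⟩
  obtain ⟨γ, hγ, hγK⟩ := hnear e
  obtain ⟨τ, hτF, hτ⟩ := Set.mem_iUnion₂.1 (hF hγK)
  refine ⟨γ + τ, ?_, by simpa using hτ⟩
  have h1 : ‖p τ‖ ≤ ∑ τ ∈ F, ‖p τ‖ :=
    Finset.single_le_sum (f := fun τ => ‖p τ‖) (fun _ _ => norm_nonneg _) hτF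
  have h2 : dist (p (γ + τ)) e ≤ ‖p τ‖ + dist (p γ) e := by
    rw [map_add, dist_eq_norm, dist_eq_norm, add_sub_right_comm, add_comm]
    exact norm_add_le _ _
  linarith [le_max_left R 0]

/-- Every point of `E` lies in at most `M` of the unit balls around the elements over `K`, where `M`
is the number of elements over `closedBall 0 2` and `K - K`; integrate this over `B`. -/
theorem IsCutProject.exists_packing_bound [MeasurableSpace E] [BorelSpace E] (vol : Measure E)
    [vol.IsAddHaarMeasure] (h : IsCutProject p q) {K : Set H} (hK : IsCompact K) :
    ∃ M : ℕ, ∀ A B : Set E, MeasurableSet B → (∀ x ∈ A, ball x 1 ⊆ B) →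
      ({γ | p γ ∈ A ∧ q γ ∈ K}.ncard : ENNReal) * vol (ball 0 1) ≤ M * vol B := by
  classical
  have hfin := h.finite_slab 2 (isCompact_sub hK hK)
  refine ⟨hfin.toFinset.card, fun A B hB hAB => ?_⟩
  by_cases hT : {γ | p γ ∈ A ∧ q γ ∈ K}.Finite
  swap
  · simp [Set.Infinite.ncard hT]
  rw [Set.ncard_eq_toFinset_card _ hT]
  have hpt : ∀ e : E, ∑ γ ∈ hT.toFinset, (ball (p γ) 1).indicator (fun _ => (1 : ENNReal)) e ≤
      B.indicator (fun _ => (hfin.toFinset.card : ENNReal)) e := by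
    intro e
    by_cases he : e ∈ B
    · rw [Set.indicator_of_mem he]
      simp only [Set.indicator_apply]
      rw [Finset.sum_ite, Finset.sum_const_zero, add_zero, Finset.sum_const, nsmul_one]
      norm_cast
      rcases Finset.eq_empty_or_nonempty {γ ∈ hT.toFinset | e ∈ ball (p γ) 1} with h0 | ⟨γ₀, h0⟩
      · rw [h0]; simp
      -- Two elements whose unit balls contain `e` differ by an element over `closedBall 0 2`.
      refine Finset.card_le_card_of_injOn (fun γ => γ - γ₀) ?_ fun a _ b _ hab => by simpa using hab
      intro γ hγ
      simp only [Finset.coe_filter, Finset.mem_filter, Set.Finite.mem_toFinset,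
        Set.mem_ofPred_eq, mem_ball] at hγ h0
      simp only [Set.Finite.coe_toFinset, Set.mem_ofPred_eq, map_sub]
      refine ⟨?_, Set.sub_mem_sub hγ.1.2 h0.1.2⟩
      rw [← dist_eq_norm]
      have := dist_triangle_left (p γ) (p γ₀) e
      linarith [hγ.2, h0.2]
    · rw [Set.indicator_of_notMem he, nonpos_iff_eq_zero]
      refine Finset.sum_eq_zero fun γ hγ => Set.indicator_of_notMem (fun h1 => he ?_) _
      exact hAB _ ((Set.Finite.mem_toFinset hT).1 hγ).1 h1
  calc (hT.toFinset.card : ENNReal) * vol (ball 0 1)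
      = ∑ γ ∈ hT.toFinset, vol (ball (p γ) 1) := by
        simp [Measure.addHaar_ball_center vol]
    _ = ∑ γ ∈ hT.toFinset, ∫⁻ e, (ball (p γ) 1).indicator (fun _ => (1 : ENNReal)) e ∂vol := by
        simp [lintegral_indicator measurableSet_ball]
    _ = ∫⁻ e, ∑ γ ∈ hT.toFinset, (ball (p γ) 1).indicator (fun _ => (1 : ENNReal)) e ∂vol :=
        (lintegral_finsetSum _ fun γ _ => measurable_const.indicator measurableSet_ball).symm
    _ ≤ ∫⁻ e, B.indicator (fun _ => (hfin.toFinset.card : ENNReal)) e ∂vol := lintegral_mono hpt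
    _ = hfin.toFinset.card * vol B := by simp [lintegral_indicator hB]

variable [NormedSpace ℝ E] [FiniteDimensional ℝ E]

theorem IsCutProject.exists_ncard_ball_le (h : IsCutProject p q) {K : Set H} (hK : IsCompact K) :
    ∃ C : ℝ, 0 ≤ C ∧ ∀ s : ℝ, 1 ≤ s →
      ({γ | ‖p γ‖ < s ∧ q γ ∈ K}.ncard : ℝ) ≤ C * s ^ finrank ℝ E := by
  borelize E
  let vol : Measure E := Measure.addHaar
  obtain ⟨M, hM⟩ := h.exists_packing_bound vol hK
  refine ⟨M * 2 ^ finrank ℝ E, by positivity, fun s hs => ?_⟩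
  have h1 := hM (ball 0 s) (ball 0 (s + 1)) measurableSet_ball fun x hx => ball_subset_ball' (by
    have := mem_ball.1 hx; linarith)
  rw [vol.addHaar_ball_of_pos 0 (r := s + 1) (by linarith), ← mul_assoc,
    ENNReal.mul_le_mul_iff_left (measure_ball_pos vol 0 one_pos).ne' measure_ball_lt_top.ne] at h1
  simp only [mem_ball_zero_iff] at h1
  have h2 := ENNReal.toReal_mono (by finiteness) h1
  rw [ENNReal.toReal_mul, ENNReal.toReal_natCast, ENNReal.toReal_natCast,
    ENNReal.toReal_ofReal (by positivity)] at h2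
  refine h2.trans ?_
  rw [mul_assoc, ← mul_pow]
  gcongr
  linarith

theorem tendsto_pow_add_sub_pow_sub_div (n : ℕ) (b : ℝ) :
    Tendsto (fun s : ℝ => ((s + b) ^ n - (s - b) ^ n) / s ^ n) atTop (𝓝 0) := by
  have h1 : Tendsto (fun s : ℝ => b / s) atTop (𝓝 0) := tendsto_const_nhds.div_atTop tendsto_id
  have h2 : Tendsto (fun s : ℝ => (1 + b / s) ^ n - (1 - b / s) ^ n) atTop (𝓝 0) := by
    simpa using ((h1.const_add 1).pow n).sub ((h1.const_sub 1).pow n)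
  refine h2.congr' ?_
  filter_upwards [eventually_gt_atTop 0] with s hs
  rw [sub_div, ← div_pow, ← div_pow, add_div, sub_div, div_self hs.ne']

/-- The number of elements over `K` in a spherical shell of fixed width and radius `s` is of smaller
order than the volume of the ball of radius `s`. -/
theorem IsCutProject.tendsto_ncard_annulus (h : IsCutProject p q) {K : Set H} (hK : IsCompact K)
    (a : ℝ) :
    Tendsto (fun s : ℝ => ({γ | (s - a ≤ ‖p γ‖ ∧ ‖p γ‖ < s + a) ∧ q γ ∈ K}.ncard : ℝ) /
      s ^ finrank ℝ E) atTop (𝓝 0) := by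
  borelize E
  let vol : Measure E := Measure.addHaar
  obtain ⟨M, hM⟩ := h.exists_packing_bound vol hK
  have hlim := (tendsto_pow_add_sub_pow_sub_div (finrank ℝ E) (|a| + 1)).const_mul (M : ℝ)
  rw [mul_zero] at hlim
  refine squeeze_zero' ?_ ?_ hlim
  · filter_upwards [eventually_ge_atTop 0] with s hs
    positivity
  filter_upwards [eventually_gt_atTop (|a| + 1)] with s hs
  have ha0 := abs_nonneg a
  have ha1 := le_abs_self a
  have hs0 : 0 < s := by linarith
  rw [← mul_div_assoc]
  gcongr
  have h1 := hM {x | s - a ≤ ‖x‖ ∧ ‖x‖ < s + a} (ball 0 (s + (|a| + 1)) \ ball 0 (s - (|a| + 1)))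
    (measurableSet_ball.diff measurableSet_ball) fun x hx y hy => by
      obtain ⟨hx1, hx2⟩ := hx
      rw [mem_ball, dist_eq_norm] at hy
      have h3 := norm_sub_norm_le y x
      have h4 := norm_sub_norm_le x y
      rw [norm_sub_rev] at h4
      refine ⟨?_, ?_⟩
      · rw [mem_ball_zero_iff]; linarith
      · rw [mem_ball_zero_iff]; linarith
  rw [measure_sdiff (ball_subset_ball (by linarith)) measurableSet_ball.nullMeasurableSet
    measure_ball_lt_top.ne, vol.addHaar_ball_of_pos 0 (r := s + _) (by linarith),
    vol.addHaar_ball_of_pos 0 (r := s - _) (by linarith), ← ENNReal.sub_mul (by finiteness),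
    ← mul_assoc,
    ENNReal.mul_le_mul_iff_left (measure_ball_pos vol 0 one_pos).ne' measure_ball_lt_top.ne,
    ← ENNReal.ofReal_sub _ (by apply pow_nonneg; linarith)] at h1
  have h2 := ENNReal.toReal_mono (by finiteness) h1
  rw [ENNReal.toReal_mul, ENNReal.toReal_natCast, ENNReal.toReal_natCast,
    ENNReal.toReal_ofReal] at h2
  · exact h2
  · rw [sub_nonneg]
    gcongr
    linarith

/-- By relative density, balls of a fixed radius around the elements over `U` of norm less than `s`
cover `ball 0 (s - R)`; compare volumes. -/
theorem IsCutProject.exists_le_ncard_ball (h : IsCutProject p q) {K : Set H} (hK : IsCompact K)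
    {U : Set H} (hU : IsOpen U) (hne : U.Nonempty) (hUK : U ⊆ K) :
    ∃ c : ℝ, 0 < c ∧ ∀ᶠ s : ℝ in atTop,
      c * s ^ finrank ℝ E ≤ ({γ | ‖p γ‖ < s ∧ q γ ∈ U}.ncard : ℝ) := by
  borelize E
  let vol : Measure E := Measure.addHaar
  obtain ⟨R, hR, hdense⟩ := h.exists_relativelyDense hU hne
  refine ⟨1 / (2 * R) ^ finrank ℝ E, by positivity, ?_⟩
  filter_upwards [eventually_gt_atTop (2 * R)] with s hs
  have hfin : {γ | ‖p γ‖ < s ∧ q γ ∈ U}.Finite :=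
    (h.finite_ball hK s).subset fun γ hγ => ⟨hγ.1, hUK hγ.2⟩
  rw [Set.ncard_eq_toFinset_card _ hfin]
  have hcov : ball (0 : E) (s - R) ⊆ ⋃ γ ∈ hfin.toFinset, ball (p γ) R := by
    intro e he
    obtain ⟨γ, hγ, hγU⟩ := hdense e
    rw [mem_ball_zero_iff] at he
    refine Set.mem_iUnion₂.2 ⟨γ, ?_, by rwa [mem_ball']⟩
    rw [Set.Finite.mem_toFinset]
    refine ⟨?_, hγU⟩
    rw [dist_eq_norm] at hγ
    have := norm_sub_norm_le (p γ) e
    linarith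
  have h1 := (measure_mono hcov).trans (measure_biUnion_finset_le (μ := vol) _ _)
  simp only [vol.addHaar_ball_of_pos _ hR, Finset.sum_const, nsmul_eq_mul] at h1
  rw [vol.addHaar_ball_of_pos 0 (r := s - R) (by linarith), ← mul_assoc,
    ENNReal.mul_le_mul_iff_left (measure_ball_pos vol 0 one_pos).ne' measure_ball_lt_top.ne] at h1
  have h2 := ENNReal.toReal_mono (by finiteness) h1
  rw [ENNReal.toReal_mul, ENNReal.toReal_natCast,
    ENNReal.toReal_ofReal (pow_nonneg hR.le _),
    ENNReal.toReal_ofReal (by apply pow_nonneg; linarith)] at h2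
  rw [one_div_mul_eq_div, div_le_iff₀ (by positivity), mul_pow, mul_left_comm]
  calc s ^ finrank ℝ E ≤ (2 * (s - R)) ^ finrank ℝ E :=
        pow_le_pow_left₀ (by linarith) (by linarith) _
    _ = 2 ^ finrank ℝ E * (s - R) ^ finrank ℝ E := mul_pow _ _ _
    _ ≤ _ := by gcongr

end Counting

/-! ### Equidistribution for continuous test functions -/

section BallSum

open Metric Module

variable {ι E H : Type*} [AddCommGroup ι] [NormedAddCommGroup E]
  [AddCommGroup H] [TopologicalSpace H]

theorem abs_finsum_le_mul_ncard {α : Type*} {g : α → ℝ} {T : Set α} (hT : T.Finite) {c : ℝ}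
    (hg : ∀ x ∉ T, g x = 0) (hc : ∀ x, |g x| ≤ c) : |∑ᶠ x, g x| ≤ c * T.ncard := by
  rw [finsum_eq_sum_of_support_subset (s := hT.toFinset) g fun x hx => by
    by_contra h1
    exact hx (hg x (by simpa using h1)), Set.ncard_eq_toFinset_card _ hT, mul_comm,
    ← nsmul_eq_mul]
  exact (Finset.abs_sum_le_sum_abs _ _).trans (Finset.sum_le_card_nsmul _ _ _ fun x _ => hc x)

/-- The sum of `f (q γ)` over all `γ` with `‖p γ‖ < s`. It is used for `f` vanishing off a compact
set, where only finitely many terms are nonzero. -/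
noncomputable def ballSum (p : ι →+ E) (q : ι →+ H) (f : H → ℝ) (s : ℝ) : ℝ :=
  ∑ᶠ γ, (ball (0 : E) s).indicator (fun _ => (1 : ℝ)) (p γ) * f (q γ)

variable {p : ι →+ E} {q : ι →+ H}

theorem IsCutProject.ballSum_eq_sum (h : IsCutProject p q) {K : Set H} (hK : IsCompact K)
    {f : H → ℝ} (hf : ∀ u ∉ K, f u = 0) (s : ℝ) :
    ballSum p q f s = ∑ γ ∈ (h.finite_ball hK s).toFinset, f (q γ) := by
  rw [ballSum, finsum_eq_sum_of_support_subset (s := (h.finite_ball hK s).toFinset)]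
  · refine Finset.sum_congr rfl fun γ hγ => ?_
    rw [Set.Finite.mem_toFinset] at hγ
    rw [Set.indicator_of_mem (by simpa using hγ.1), one_mul]
  · intro γ hγ
    rw [Set.Finite.coe_toFinset]
    refine ⟨?_, ?_⟩
    · by_contra h1
      exact hγ (by simp only; rw [Set.indicator_of_notMem (by simpa using h1), zero_mul])
    · by_contra h1
      exact hγ (by simp only; rw [hf _ h1, mul_zero])

theorem IsCutProject.abs_ballSum_sub_le (h : IsCutProject p q) {K : Set H} (hK : IsCompact K)
    {f g : H → ℝ} (hf : ∀ u ∉ K, f u = 0) (hg : ∀ u ∉ K, g u = 0) {c : ℝ}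
    (hc : ∀ u, |f u - g u| ≤ c) (s : ℝ) :
    |ballSum p q f s - ballSum p q g s| ≤ c * ({γ | ‖p γ‖ < s ∧ q γ ∈ K}.ncard : ℝ) := by
  rw [h.ballSum_eq_sum hK hf, h.ballSum_eq_sum hK hg, ← Finset.sum_sub_distrib,
    Set.ncard_eq_toFinset_card _ (h.finite_ball hK s), mul_comm, ← nsmul_eq_mul]
  exact (Finset.abs_sum_le_sum_abs _ _).trans (Finset.sum_le_card_nsmul _ _ _ fun x _ => hc _)

theorem IsCutProject.abs_ballSum_le (h : IsCutProject p q) {K : Set H} (hK : IsCompact K)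
    {f : H → ℝ} (hf : ∀ u ∉ K, f u = 0) {c : ℝ}
    (hc : ∀ u, |f u| ≤ c) (s : ℝ) :
    |ballSum p q f s| ≤ c * ({γ | ‖p γ‖ < s ∧ q γ ∈ K}.ncard : ℝ) := by
  have h0 : ballSum p q (fun _ => 0) s = 0 := by simp [ballSum]
  simpa [h0] using h.abs_ballSum_sub_le hK hf (g := fun _ => 0) (fun _ _ => rfl) (c := c)
    (by simpa using hc) s

/-- Translating `f` by `q τ` amounts to summing over the ball around `p τ` instead of the ball
around `0`; the symmetric difference of the two balls lies in a shell of width `2 ‖p τ‖`. -/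
theorem IsCutProject.abs_ballSum_translate_sub_le (h : IsCutProject p q) {K : Set H}
    (hK : IsCompact K) {f : H → ℝ} (hf : ∀ u ∉ K, f u = 0) {c : ℝ}
    (hc : ∀ u, |f u| ≤ c) (τ : ι) (s : ℝ) :
    |ballSum p q (fun u => f (u + q τ)) s - ballSum p q f s| ≤
      c * ({γ | (s - ‖p τ‖ ≤ ‖p γ‖ ∧ ‖p γ‖ < s + ‖p τ‖) ∧ q γ ∈ K}.ncard : ℝ) := by
  have hc0 : 0 ≤ c := (abs_nonneg _).trans (hc 0)
  have hfin : {γ | ‖p γ‖ ≤ s + ‖p τ‖ ∧ q γ ∈ K}.Finite := h.finite_slab _ hK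
  have h1 : ballSum p q (fun u => f (u + q τ)) s =
      ∑ᶠ γ, (ball (0 : E) s).indicator (fun _ => (1 : ℝ)) (p γ - p τ) * f (q γ) := by
    rw [ballSum, ← finsum_comp_equiv (Equiv.subRight τ)]
    simp
  have htri (γ : ι) : ‖p γ‖ ≤ ‖p γ - p τ‖ + ‖p τ‖ := by
    simpa using norm_add_le (p γ - p τ) (p τ)
  have htri' (γ : ι) : ‖p γ - p τ‖ ≤ ‖p γ‖ + ‖p τ‖ := norm_sub_le _ _
  rw [h1, ballSum, ← finsum_sub_distrib]
  · refine abs_finsum_le_mul_ncard (hfin.subset fun γ hγ => ⟨hγ.1.2.le, hγ.2⟩) ?_ ?_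
    · intro γ hγ
      by_cases hq : q γ ∈ K
      swap
      · simp [hf _ hq]
      by_cases h2 : ‖p γ‖ < s <;> by_cases h3 : ‖p γ - p τ‖ < s
      · simp [h2, h3]
      · exact absurd ⟨⟨by linarith [htri' γ], by linarith [norm_nonneg (p τ)]⟩, hq⟩ hγ
      · exact absurd ⟨⟨by linarith [norm_nonneg (p τ)], by linarith [htri γ]⟩, hq⟩ hγ
      · simp [h2, h3]
    · intro γ
      by_cases h2 : ‖p γ‖ < s <;> by_cases h3 : ‖p γ - p τ‖ < s <;> simp [h2, h3, hc, hc0]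
  · refine hfin.subset fun γ hγ => ⟨?_, ?_⟩
    · by_contra h4
      refine hγ ?_
      simp only
      rw [Set.indicator_of_notMem, zero_mul]
      rw [mem_ball_zero_iff]
      linarith [htri γ]
    · by_contra h4
      exact hγ (by simp only; rw [hf _ h4, mul_zero])
  · refine hfin.subset fun γ hγ => ⟨?_, ?_⟩
    · by_contra h4
      refine hγ ?_
      simp only
      rw [Set.indicator_of_notMem, zero_mul]
      rw [mem_ball_zero_iff]
      linarith [norm_nonneg (p τ)]
    · by_contra h4
      exact hγ (by simp only; rw [hf _ h4, mul_zero])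

variable [IsTopologicalAddGroup H]

/-- Uniform continuity of `f`, in a form that needs no uniform structure on `H`. -/
theorem HasCompactSupport.eventually_forall_abs_translate_sub_le [LocallyCompactSpace H] {f : H → ℝ}
    (hf : Continuous f) (hsupp : HasCompactSupport f) (h : H) {ε : ℝ} (hε : 0 < ε) :
    ∀ᶠ t in 𝓝 h, ∀ u, |f (u + h) - f (u + t)| ≤ ε := by
  obtain ⟨V, hV, hVh⟩ := exists_compact_mem_nhds h
  have h1 : ∀ᶠ t in 𝓝 h, ∀ u ∈ tsupport f - V, |f (u + h) - f (u + t)| < ε := by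
    refine (isCompact_sub hsupp hV).eventually_forall_of_forall_eventually fun u _ => ?_
    have hc : Continuous fun z : H × H => |f (z.2 + h) - f (z.2 + z.1)| := by fun_prop
    exact hc.continuousAt.eventually (gt_mem_nhds (by simpa using hε))
  filter_upwards [h1, hVh] with t ht htV u
  by_cases hu : u ∈ tsupport f - V
  · exact (ht u hu).le
  have h0 : ∀ t ∈ V, f (u + t) = 0 := fun t ht => image_eq_zero_of_notMem_tsupport fun h2 =>
    hu ⟨u + t, h2, t, ht, by simp⟩
  rw [h0 h (mem_of_mem_nhds hVh), h0 t htV]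
  simpa using hε.le

/-- Exchange of the finite sum with the integral, followed by the substitution of `h - q γ` for `h`
in each term. -/
theorem IsCutProject.integral_ballSum_translate_mul [MeasurableSpace H] [BorelSpace H]
    (μ : Measure H) [IsFiniteMeasureOnCompacts μ] [μ.IsAddLeftInvariant]
    (hpq : IsCutProject p q) {f φ : H → ℝ} (hf : Continuous f) (hfs : HasCompactSupport f)
    (hφ : Continuous φ) (hφs : HasCompactSupport φ) (s : ℝ) :
    Integrable (fun h => ballSum p q (fun u => f (u + h)) s * φ h) μ ∧
    Integrable (fun h => ballSum p q (fun u => φ (-(u + -h))) s * f h) μ ∧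
    ∫ h, ballSum p q (fun u => f (u + h)) s * φ h ∂μ =
      ∫ h, ballSum p q (fun u => φ (-(u + -h))) s * f h ∂μ := by
  have hK : IsCompact (tsupport f - tsupport φ) := isCompact_sub hfs hφs
  have e1 : (fun h => ballSum p q (fun u => f (u + h)) s * φ h) = fun h =>
      ∑ γ ∈ (hpq.finite_ball hK s).toFinset, f (q γ + h) * φ h := by
    ext h
    by_cases hh : h ∈ tsupport φ
    · rw [hpq.ballSum_eq_sum hK, Finset.sum_mul]
      exact fun u hu => image_eq_zero_of_notMem_tsupport fun h2 => hu ⟨u + h, h2, h, hh, by simp⟩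
    · simp [image_eq_zero_of_notMem_tsupport hh]
  have e2 : (fun h => ballSum p q (fun u => φ (-(u + -h))) s * f h) = fun h =>
      ∑ γ ∈ (hpq.finite_ball hK s).toFinset, φ (-(q γ + -h)) * f h := by
    ext h
    by_cases hh : h ∈ tsupport f
    · rw [hpq.ballSum_eq_sum hK (f := fun u => φ (-(u + -h))), Finset.sum_mul]
      exact fun u hu => image_eq_zero_of_notMem_tsupport fun h2 =>
        hu ⟨h, hh, -(u + -h), h2, by simp⟩
    · simp [image_eq_zero_of_notMem_tsupport hh]
  have i1 (v : H) : Integrable (fun h => f (v + h) * φ h) μ :=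
    Continuous.integrable_of_hasCompactSupport (by fun_prop) hφs.mul_left
  have i2 (v : H) : Integrable (fun h => φ (-(v + -h)) * f h) μ :=
    Continuous.integrable_of_hasCompactSupport (by fun_prop) hfs.mul_left
  rw [e1, e2]
  refine ⟨integrable_finsetSum _ fun γ _ => i1 _, integrable_finsetSum _ fun γ _ => i2 _, ?_⟩
  rw [integral_finsetSum _ fun γ _ => i1 _, integral_finsetSum _ fun γ _ => i2 _]
  refine Finset.sum_congr rfl fun γ _ => ?_
  rw [← integral_add_left_eq_self (fun h => φ (-(q γ + -h)) * f h) (q γ)]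
  congr 1 with h
  rw [mul_comm]
  congr 2
  abel

variable [NormedSpace ℝ E] [FiniteDimensional ℝ E]

/-- Asymptotic invariance of `ballSum` under all translations of `H`: translations by `q τ` cost
only a shell, and an arbitrary `h` is approximated by elements `q τ`, uniformly on the support
of `f`. -/
theorem IsCutProject.tendsto_ballSum_translate_sub [LocallyCompactSpace H]
    (hpq : IsCutProject p q) {f : H → ℝ} (hf : Continuous f) (hsupp : HasCompactSupport f) (h : H) :
    Tendsto (fun s => (ballSum p q (fun u => f (u + h)) s - ballSum p q f s) / s ^ finrank ℝ E)
      atTop (𝓝 0) := by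
  obtain ⟨V, hV, hVh⟩ := exists_compact_mem_nhds h
  obtain ⟨C, hC0, hC⟩ := hpq.exists_ncard_ball_le (isCompact_sub hsupp hV)
  obtain ⟨c, hc⟩ := hf.bounded_above_of_compact_support hsupp
  simp only [Real.norm_eq_abs] at hc
  have h0 : ∀ t ∈ V, ∀ u ∉ tsupport f - V, f (u + t) = 0 := fun t ht u hu =>
    image_eq_zero_of_notMem_tsupport fun h2 => hu ⟨u + t, h2, t, ht, by simp⟩
  rw [Metric.tendsto_atTop']
  intro ε hε
  obtain ⟨τ, hτV, hτ⟩ := hpq.denseRange.mem_nhds (Filter.inter_mem hVh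
    (hsupp.eventually_forall_abs_translate_sub_le hf h (ε := ε / (2 * (C + 1))) (by positivity)))
  have hann := (hpq.tendsto_ncard_annulus hsupp ‖p τ‖).const_mul c
  rw [mul_zero] at hann
  replace hann := hann.eventually (gt_mem_nhds (half_pos hε))
  obtain ⟨N, hN⟩ := eventually_atTop.1 hann
  refine ⟨max N 1, fun s hs => ?_⟩
  have hs1 : 1 < s := (le_max_right _ _).trans_lt hs
  have hsn : 0 < s ^ finrank ℝ E := by positivity
  have h1 := hpq.abs_ballSum_sub_le (isCompact_sub hsupp hV) (h0 h (mem_of_mem_nhds hVh))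
    (h0 (q τ) hτV) hτ s
  have h2 := hpq.abs_ballSum_translate_sub_le hsupp
    (fun u hu => image_eq_zero_of_notMem_tsupport hu) hc τ s
  have h3 := hN s ((le_max_left _ _).trans hs.le)
  rw [← mul_div_assoc, div_lt_iff₀ hsn] at h3
  have h4 : ε / (2 * (C + 1)) * ({γ | ‖p γ‖ < s ∧ q γ ∈ tsupport f - V}.ncard : ℝ) <
      ε / 2 * s ^ finrank ℝ E := by
    calc _ ≤ ε / (2 * (C + 1)) * (C * s ^ finrank ℝ E) := by gcongr; exact hC s hs1.le
      _ = ε / 2 * s ^ finrank ℝ E * (C / (C + 1)) := by field_simp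
      _ < ε / 2 * s ^ finrank ℝ E := by
        refine mul_lt_of_lt_one_right (by positivity) ?_
        rw [div_lt_one (by positivity)]
        linarith
  rw [Real.dist_eq, sub_zero, abs_div, abs_of_pos hsn, div_lt_iff₀ hsn]
  refine (abs_sub_le _ (ballSum p q (fun u => f (u + q τ)) s) _).trans_lt ?_
  linarith

variable [MeasurableSpace H] [BorelSpace H] (μ : Measure H) [IsFiniteMeasureOnCompacts μ]

/-- The asymptotic invariance integrated against `ψ`, by dominated convergence. The map `k` is the
identity or the negation in the two applications. -/
theorem IsCutProject.tendsto_integral_ballSum_translate_sub [LocallyCompactSpace H]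
    (hpq : IsCutProject p q) {f ψ : H → ℝ} (hf : Continuous f) (hfs : HasCompactSupport f)
    (hψ : Continuous ψ) (hψs : HasCompactSupport ψ) {k : H → H} (hk : Continuous k) :
    Tendsto (fun s => ∫ h, (ballSum p q (fun u => f (u + k h)) s - ballSum p q f s) /
      s ^ finrank ℝ E * ψ h ∂μ) atTop (𝓝 0) := by
  have hK : IsCompact (tsupport f - k '' tsupport ψ) := isCompact_sub hfs (hψs.image hk)
  obtain ⟨C, hC0, hC⟩ := hpq.exists_ncard_ball_le hK
  obtain ⟨C', hC0', hC'⟩ := hpq.exists_ncard_ball_le hfs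
  obtain ⟨c, hc⟩ := hf.bounded_above_of_compact_support hfs
  simp only [Real.norm_eq_abs] at hc
  have hc0 : 0 ≤ c := (abs_nonneg _).trans (hc 0)
  have h0 : ∀ h ∈ tsupport ψ, ∀ u ∉ tsupport f - k '' tsupport ψ, f (u + k h) = 0 :=
    fun t ht u hu => image_eq_zero_of_notMem_tsupport fun h2 =>
      hu ⟨u + k t, h2, k t, Set.mem_image_of_mem _ ht, by simp⟩
  have key : Tendsto (fun s => ∫ h, (ballSum p q (fun u => f (u + k h)) s - ballSum p q f s) /
      s ^ finrank ℝ E * ψ h ∂μ) atTop (𝓝 (∫ h, 0 * ψ h ∂μ)) := by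
    refine tendsto_integral_filter_of_dominated_convergence (fun h => (c * C + c * C') * |ψ h|)
      (Eventually.of_forall fun s => ?_) ?_ ?_ ?_
    · have hcont : Continuous fun h => (∑ γ ∈ (hpq.finite_ball hK s).toFinset, f (q γ + k h) -
          ballSum p q f s) / s ^ finrank ℝ E * ψ h := by fun_prop
      refine hcont.aestronglyMeasurable.congr (Eventually.of_forall fun h => ?_)
      by_cases hh : h ∈ tsupport ψ
      · simp only
        rw [hpq.ballSum_eq_sum hK (h0 h hh)]
      · simp [image_eq_zero_of_notMem_tsupport hh]
    · filter_upwards [eventually_ge_atTop 1] with s hs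
      have hsn : 0 < s ^ finrank ℝ E := by positivity
      refine Eventually.of_forall fun h => ?_
      by_cases hh : h ∈ tsupport ψ
      · rw [norm_mul, Real.norm_eq_abs, Real.norm_eq_abs, abs_div, abs_of_pos hsn]
        gcongr
        rw [div_le_iff₀ hsn]
        refine (abs_sub _ _).trans ?_
        have h1 := hpq.abs_ballSum_le hK (h0 h hh) (c := c) (fun u => hc _) s
        have h2 := hpq.abs_ballSum_le hfs
          (fun u hu => image_eq_zero_of_notMem_tsupport hu) hc s
        have h3 := mul_le_mul_of_nonneg_left (hC s hs) hc0
        have h4 := mul_le_mul_of_nonneg_left (hC' s hs) hc0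
        linarith
      · simp [image_eq_zero_of_notMem_tsupport hh]
    · exact ((hψ.integrable_of_hasCompactSupport hψs).abs).const_mul _
    · refine Eventually.of_forall fun h => ?_
      exact (hpq.tendsto_ballSum_translate_sub hf hfs (k h)).mul_const _
  simpa using key

/-- `ballSum` is asymptotically proportional to the Haar integral. Both
`(∑ f) (∫ φ)` and `(∑ φ (-·)) (∫ f)` are, up to smaller order, the common value of the two integrals
of `integral_ballSum_translate_mul`. -/
theorem IsCutProject.tendsto_ballSum_mul_integral_sub [LocallyCompactSpace H]
    [μ.IsAddLeftInvariant] (hpq : IsCutProject p q) {f φ : H → ℝ} (hf : Continuous f)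
    (hfs : HasCompactSupport f) (hφ : Continuous φ) (hφs : HasCompactSupport φ) :
    Tendsto (fun s => (ballSum p q f s * ∫ h, φ h ∂μ -
      ballSum p q (fun u => φ (-u)) s * ∫ h, f h ∂μ) / s ^ finrank ℝ E) atTop (𝓝 0) := by
  have t1 := hpq.tendsto_integral_ballSum_translate_sub μ hf hfs hφ hφs (k := fun h => h)
    continuous_id
  have t2 := hpq.tendsto_integral_ballSum_translate_sub μ (f := fun u => φ (-u))
    (hφ.comp continuous_neg) (hφs.comp_homeomorph (Homeomorph.neg H)) hf hfs (k := fun h => -h)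
    continuous_neg
  have t3 := t2.sub t1
  rw [sub_zero] at t3
  refine t3.congr fun s => ?_
  obtain ⟨i1, i2, e⟩ := hpq.integral_ballSum_translate_mul μ hf hfs hφ hφs s
  have j1 := hφ.integrable_of_hasCompactSupport (μ := μ) hφs
  have j2 := hf.integrable_of_hasCompactSupport (μ := μ) hfs
  simp only [div_mul_eq_mul_div, sub_mul]
  rw [integral_div, integral_div, integral_sub i1 (j1.const_mul _),
    integral_sub i2 (j2.const_mul _), e, integral_const_mul, integral_const_mul]
  ring

end BallSum

/-! ### Approximating windows by continuous functions -/

section Windows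

variable {H : Type*} [TopologicalSpace H] [MeasurableSpace H]

theorem measureReal_eq_of_null_frontier {ν : Measure H} {W : Set H} (hW : ν (frontier W) = 0) :
    ν.real (interior W) = ν.real W ∧ ν.real (closure W) = ν.real W :=
  ⟨measureReal_congr (interior_ae_eq_of_null_frontier hW),
    measureReal_congr (closure_ae_eq_of_null_frontier hW)⟩

variable [BorelSpace H] [LocallyCompactSpace H] [T2Space H]

/-- The interior of `W` has full measure in `W` and is approximated from inside by compact sets. -/
theorem exists_le_indicator_lt_integral (ν : Measure H) [ν.Regular] {W : Set H}
    (hc : IsCompact (closure W)) (hW : ν (frontier W) = 0) {a : ℝ} (ha : a < ν.real W) :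
    ∃ f : H → ℝ, Continuous f ∧ HasCompactSupport f ∧ (∀ u, f u ≤ W.indicator 1 u) ∧
      a < ∫ u, f u ∂ν := by
  rcases lt_or_ge a 0 with h0 | h0
  · refine ⟨fun _ => 0, continuous_const, HasCompactSupport.zero, fun u => ?_, by simpa using h0⟩
    exact Set.indicator_nonneg (fun _ _ => zero_le_one) u
  rw [← (measureReal_eq_of_null_frontier hW).1] at ha
  have hfin : ν (interior W) ≠ ⊤ :=
    ((measure_mono (interior_subset.trans subset_closure)).trans_lt hc.measure_lt_top).ne
  obtain ⟨K, hKW, hK, hKa⟩ := isOpen_interior.exists_lt_isCompact (μ := ν)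
    ((ENNReal.ofReal_lt_iff_lt_toReal h0 hfin).2 ha)
  obtain ⟨f, hf1, hf0, hfs, hf01⟩ := exists_continuous_one_zero_of_isCompact hK
    (isOpen_interior (s := W)).isClosed_compl (Set.disjoint_compl_right_iff_subset.2 hKW)
  refine ⟨f, f.continuous, hfs, fun u => ?_, ?_⟩
  · by_cases hu : u ∈ W
    · simpa [hu] using (hf01 u).2
    · simpa [hu] using (hf0 fun h => hu (interior_subset h)).le
  · rw [ENNReal.ofReal_lt_iff_lt_toReal h0 hK.measure_lt_top.ne] at hKa
    refine hKa.trans_le ?_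
    rw [← Measure.real, ← integral_indicator_one hK.measurableSet]
    refine integral_mono ((integrable_indicator_iff hK.measurableSet).2
      (integrableOn_const hK.measure_lt_top.ne)) (f.continuous.integrable_of_hasCompactSupport hfs)
      fun u => ?_
    by_cases hu : u ∈ K
    · simpa [hu] using (hf1 hu).ge
    · simpa [hu] using (hf01 u).1

/-- The closure of `W` has the measure of `W` and is approximated from outside by open sets. -/
theorem exists_indicator_le_integral_lt (ν : Measure H) [ν.Regular] {W : Set H}
    (hc : IsCompact (closure W)) (hW : ν (frontier W) = 0) {a : ℝ} (ha : ν.real W < a) :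
    ∃ f : H → ℝ, Continuous f ∧ HasCompactSupport f ∧ (∀ u, W.indicator 1 u ≤ f u) ∧
      ∫ u, f u ∂ν < a := by
  rw [← (measureReal_eq_of_null_frontier hW).2] at ha
  have ha0 : 0 ≤ a := measureReal_nonneg.trans ha.le
  obtain ⟨U, hWU, hU, hUa⟩ := hc.exists_isOpen_lt_of_lt (μ := ν) (ENNReal.ofReal a)
    ((ENNReal.lt_ofReal_iff_toReal_lt hc.measure_lt_top.ne).2 ha)
  have hUt : ν U ≠ ⊤ := hUa.ne_top
  obtain ⟨f, hf1, hf0, hfs, hf01⟩ := exists_continuous_one_zero_of_isCompact hc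
    hU.isClosed_compl (Set.disjoint_compl_right_iff_subset.2 hWU)
  refine ⟨f, f.continuous, hfs, fun u => ?_, ?_⟩
  · by_cases hu : u ∈ W
    · simpa [hu] using (hf1 (subset_closure hu)).ge
    · simpa [hu] using (hf01 u).1
  · rw [ENNReal.lt_ofReal_iff_toReal_lt hUt] at hUa
    refine lt_of_le_of_lt ?_ hUa
    rw [← Measure.real, ← integral_indicator_one hU.measurableSet]
    refine integral_mono (f.continuous.integrable_of_hasCompactSupport hfs)
      ((integrable_indicator_iff hU.measurableSet).2 (integrableOn_const hUt))
      fun u => ?_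
    by_cases hu : u ∈ U
    · simpa [hu] using (hf01 u).2
    · simpa [hu] using (hf0 hu).le

end Windows

/-! ### Densities of model sets -/

section Density

open Metric Module

variable {ι E H : Type*} [AddCommGroup ι] [NormedAddCommGroup E] [AddCommGroup H]
  [TopologicalSpace H] {p : ι →+ E} {q : ι →+ H}

theorem IsCutProject.ballSum_mono (hpq : IsCutProject p q) {K : Set H} (hK : IsCompact K)
    {f g : H → ℝ} (hf : ∀ u ∉ K, f u = 0) (hg : ∀ u ∉ K, g u = 0) (hfg : ∀ u, f u ≤ g u) (s : ℝ) :
    ballSum p q f s ≤ ballSum p q g s := by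
  rw [hpq.ballSum_eq_sum hK hf, hpq.ballSum_eq_sum hK hg]
  exact Finset.sum_le_sum fun γ _ => hfg _

theorem IsCutProject.ballSum_indicator (hpq : IsCutProject p q) {K W : Set H} (hK : IsCompact K)
    (hW : W ⊆ K) (c s : ℝ) :
    ballSum p q (W.indicator fun _ => c) s = {γ | ‖p γ‖ < s ∧ q γ ∈ W}.ncard * c := by
  classical
  have hfin : {γ | ‖p γ‖ < s ∧ q γ ∈ W}.Finite :=
    (hpq.finite_ball hK s).subset fun γ hγ => ⟨hγ.1, hW hγ.2⟩
  rw [hpq.ballSum_eq_sum hK fun u hu => Set.indicator_of_notMem (fun h => hu (hW h)) _,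
    Set.ncard_eq_toFinset_card _ hfin, ← nsmul_eq_mul, ← Finset.sum_const]
  simp only [Set.indicator_apply]
  rw [← Finset.sum_filter]
  refine Finset.sum_congr ?_ fun _ _ => rfl
  ext γ
  simp only [Finset.mem_filter, Set.Finite.mem_toFinset, Set.mem_ofPred_eq]
  exact ⟨fun h => ⟨h.1.1, h.2⟩, fun h => ⟨⟨h.1, hW h.2⟩, h.2⟩⟩

variable [LocallyCompactSpace H] [MeasurableSpace H] [BorelSpace H]

/-- The indicator function of `W` is squeezed between continuous functions of compact support whose
integrals are close to `ν W`. -/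
theorem IsCutProject.tendsto_ncard_ball_div [T2Space H] (ν : Measure H) [ν.Regular]
    (hpq : IsCutProject p q) {A : ℝ → ℝ} (hA : ∀ᶠ s in atTop, 0 < A s)
    (hlim : ∀ f : H → ℝ, Continuous f → HasCompactSupport f →
        Tendsto (fun s => ballSum p q f s / A s) atTop (𝓝 (∫ u, f u ∂ν)))
    {W : Set H} (hc : IsCompact (closure W)) (hW : ν (frontier W) = 0) :
    Tendsto (fun s => ({γ | ‖p γ‖ < s ∧ q γ ∈ W}.ncard : ℝ) / A s) atTop (𝓝 (ν.real W)) := by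
  have e (s : ℝ) : ({γ | ‖p γ‖ < s ∧ q γ ∈ W}.ncard : ℝ) = ballSum p q (W.indicator 1) s := by
    have := hpq.ballSum_indicator hc subset_closure 1 s
    rw [mul_one] at this
    exact this.symm
  simp only [e]
  refine tendsto_order.2 ⟨fun a ha => ?_, fun a ha => ?_⟩
  · obtain ⟨f, hf, hfs, hfW, hfa⟩ := exists_le_indicator_lt_integral ν hc hW ha
    filter_upwards [hA, (hlim f hf hfs).eventually (lt_mem_nhds hfa)] with s hs h1
    refine h1.trans_le ?_
    gcongr
    refine hpq.ballSum_mono (hc.union hfs) (fun u hu => image_eq_zero_of_notMem_tsupport fun h =>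
      hu (Or.inr h)) (fun u hu => Set.indicator_of_notMem (fun h => hu (Or.inl ?_)) _) hfW s
    exact subset_closure h
  · obtain ⟨f, hf, hfs, hfW, hfa⟩ := exists_indicator_le_integral_lt ν hc hW ha
    filter_upwards [hA, (hlim f hf hfs).eventually (gt_mem_nhds hfa)] with s hs h1
    refine lt_of_le_of_lt ?_ h1
    gcongr
    refine hpq.ballSum_mono (hc.union hfs) (fun u hu => Set.indicator_of_notMem (fun h =>
      hu (Or.inl ?_)) _) (fun u hu => image_eq_zero_of_notMem_tsupport fun h =>
      hu (Or.inr h)) hfW s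
    exact subset_closure h

variable [IsTopologicalAddGroup H] [NormedSpace ℝ E] [FiniteDimensional ℝ E]

/-- A normalization `A` of `ballSum` in the limit of which the Haar integral appears. It grows at
least like the volume of the ball, so that shells are negligible relative to it. -/
theorem IsCutProject.exists_normalization (hpq : IsCutProject p q) (ν : Measure H)
    [ν.IsAddHaarMeasure] :
    ∃ (A : ℝ → ℝ) (c : ℝ), 0 < c ∧ (∀ᶠ s in atTop, c * s ^ finrank ℝ E ≤ A s) ∧
      ∀ f : H → ℝ, Continuous f → HasCompactSupport f →
        Tendsto (fun s => ballSum p q f s / A s) atTop (𝓝 (∫ u, f u ∂ν)) := by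
  -- `A` is `ballSum` of the reflection of a bump function `φ`, divided by the integral of `φ`.
  obtain ⟨φ, hφ1, -, hφs, hφ01⟩ := exists_continuous_one_zero_of_isCompact
    (isCompact_singleton (x := (0 : H))) isClosed_empty (Set.disjoint_empty _)
  replace hφ1 : φ 0 = 1 := hφ1 rfl
  have hint : 0 < ∫ u, φ u ∂ν := φ.continuous.integral_pos_of_hasCompactSupport_nonneg_nonzero hφs
    (fun u => (hφ01 u).1) (x := 0) (by simp [hφ1])
  have hφs' : HasCompactSupport fun u => φ (-u) := hφs.comp_homeomorph (Homeomorph.neg H)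
  set U : Set H := {u | 1 / 2 < φ (-u)} with hUdef
  have hU : IsOpen U := isOpen_lt continuous_const (by fun_prop)
  have hUK : U ⊆ tsupport fun u => φ (-u) := fun u hu => subset_tsupport _ (by
    have h1 : 1 / 2 < φ (-u) := hu
    exact ne_of_gt (by linarith))
  obtain ⟨c, hc, hcs⟩ := hpq.exists_le_ncard_ball hφs' hU ⟨0, by simp [hUdef, hφ1]; norm_num⟩ hUK
  have hlow (s : ℝ) : ({γ | ‖p γ‖ < s ∧ q γ ∈ U}.ncard : ℝ) * (1 / 2) ≤
      ballSum p q (fun u => φ (-u)) s := by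
    rw [← hpq.ballSum_indicator hφs' hUK]
    refine hpq.ballSum_mono hφs' (fun u hu => Set.indicator_of_notMem (fun h => hu (hUK h)) _)
      (fun u hu => image_eq_zero_of_notMem_tsupport hu) (fun u => ?_) s
    by_cases hu : u ∈ U
    · rw [Set.indicator_of_mem hu]
      exact (show 1 / 2 < φ (-u) from hu).le
    · rw [Set.indicator_of_notMem hu]
      exact (hφ01 _).1
  refine ⟨fun s => ballSum p q (fun u => φ (-u)) s / ∫ u, φ u ∂ν, c / 2 / ∫ u, φ u ∂ν,
    by positivity, ?_, fun f hf hfs => ?_⟩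
  · filter_upwards [hcs] with s hs
    rw [div_mul_eq_mul_div]
    gcongr
    linarith [hlow s]
  · have ht := hpq.tendsto_ballSum_mul_integral_sub ν hf hfs φ.continuous hφs
    rw [tendsto_iff_norm_sub_tendsto_zero]
    have ht2 := (tendsto_zero_iff_norm_tendsto_zero.1 ht).const_mul (2 / c)
    rw [mul_zero] at ht2
    refine squeeze_zero' (Eventually.of_forall fun _ => norm_nonneg _) ?_ ht2
    filter_upwards [hcs, eventually_gt_atTop 0] with s hs hs0
    have hsn : 0 < s ^ finrank ℝ E := by positivity
    have hB : c / 2 * s ^ finrank ℝ E ≤ ballSum p q (fun u => φ (-u)) s := by linarith [hlow s]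
    set B := ballSum p q (fun u => φ (-u)) s
    have hB0 : 0 < B := lt_of_lt_of_le (by positivity) hB
    have e1 : ballSum p q f s / (B / ∫ u, φ u ∂ν) - ∫ u, f u ∂ν =
        (ballSum p q f s * ∫ u, φ u ∂ν - B * ∫ u, f u ∂ν) / B := by
      field_simp
    rw [e1, norm_div, norm_div, Real.norm_of_nonneg hB0.le, Real.norm_of_nonneg hsn.le]
    calc _ ≤ ‖ballSum p q f s * ∫ u, φ u ∂ν - B * ∫ u, f u ∂ν‖ / (c / 2 * s ^ finrank ℝ E) := by
          gcongr
      _ = _ := by field_simp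

/-- The number of elements over a window is asymptotically proportional to its Haar measure. The
elements are taken from sets `Q s` that agree with the ball of radius `s` up to a shell of fixed
width `D`. -/
theorem IsCutProject.tendsto_ncard_div_ncard [T2Space H] (μ : Measure H) [μ.IsAddHaarMeasure]
    (hpq : IsCutProject p q) {D : ℝ} (hD : 0 ≤ D) {Q : ℝ → Set ι}
    (hQ₁ : ∀ s, {γ | ‖p γ‖ < s - D} ⊆ Q s) (hQ₂ : ∀ s, Q s ⊆ {γ | ‖p γ‖ < s})
    {W W₀ : Set H} (hc : IsCompact (closure W)) (hW : μ (frontier W) = 0)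
    (hc₀ : IsCompact (closure W₀)) (hW₀ : μ (frontier W₀) = 0) (hne : μ W₀ ≠ 0) :
    Tendsto (fun s => ({γ | γ ∈ Q s ∧ q γ ∈ W}.ncard : ℝ) / ({γ | γ ∈ Q s ∧ q γ ∈ W₀}.ncard : ℝ))
      atTop (𝓝 (μ.real W / μ.real W₀)) := by
  -- The measure `μ` need not be regular, but it is proportional to the regular measure `ν` on
  -- relatively compact sets.
  let ν : Measure H := Measure.addHaar
  obtain ⟨A, c, hc0, hA, hlim⟩ := hpq.exists_normalization ν
  have hApos : ∀ᶠ s in atTop, 0 < A s := by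
    filter_upwards [hA, eventually_gt_atTop 0] with s hs hs0
    exact lt_of_lt_of_le (by positivity) hs
  have hνμ {W : Set H} (hc : IsCompact (closure W)) :
      ν W = Measure.addHaarScalarFactor ν μ • μ W :=
    Measure.measure_isAddInvariant_eq_smul_of_isCompact_closure ν μ hc
  have hreal {W : Set H} (hc : IsCompact (closure W)) :
      ν.real W = Measure.addHaarScalarFactor ν μ * μ.real W := by
    rw [Measure.real, hνμ hc]
    simp [Measure.real, ENNReal.smul_def]
  have key {W : Set H} (hc : IsCompact (closure W)) (hW : μ (frontier W) = 0) :
      Tendsto (fun s => ({γ | γ ∈ Q s ∧ q γ ∈ W}.ncard : ℝ) / A s) atTop (𝓝 (ν.real W)) := by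
    have hWν : ν (frontier W) = 0 := by
      rw [hνμ, hW, smul_zero]
      rw [isClosed_frontier.closure_eq]
      exact hc.of_isClosed_subset isClosed_frontier frontier_subset_closure
    have h1 := hpq.tendsto_ncard_ball_div ν hApos hlim hc hWν
    have h2 := (hpq.tendsto_ncard_annulus hc D).div_const c
    rw [zero_div] at h2
    have h3 := h1.sub h2
    rw [sub_zero] at h3
    refine tendsto_of_tendsto_of_tendsto_of_le_of_le' h3 h1 ?_ ?_
    · filter_upwards [hA, hApos, eventually_gt_atTop 0] with s hs hs0 hs1
      have hsn : 0 < s ^ finrank ℝ E := by positivity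
      rw [sub_le_iff_le_add, div_div, mul_comm _ c]
      have hann : {γ | (s - D ≤ ‖p γ‖ ∧ ‖p γ‖ < s + D) ∧ q γ ∈ closure W}.Finite :=
        (hpq.finite_ball hc (s + D)).subset fun γ hγ => ⟨hγ.1.2, hγ.2⟩
      have hQf : {γ | γ ∈ Q s ∧ q γ ∈ W}.Finite :=
        (hpq.finite_ball hc s).subset fun γ hγ => ⟨hQ₂ s hγ.1, subset_closure hγ.2⟩
      have hsub : {γ | ‖p γ‖ < s ∧ q γ ∈ W} ⊆ {γ | γ ∈ Q s ∧ q γ ∈ W} ∪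
          {γ | (s - D ≤ ‖p γ‖ ∧ ‖p γ‖ < s + D) ∧ q γ ∈ closure W} := fun γ hγ => by
        rcases lt_or_ge ‖p γ‖ (s - D) with h4 | h4
        · exact Or.inl ⟨hQ₁ s h4, hγ.2⟩
        · exact Or.inr ⟨⟨h4, lt_of_lt_of_le hγ.1 (by linarith)⟩, subset_closure hγ.2⟩
      have hcard : ({γ | ‖p γ‖ < s ∧ q γ ∈ W}.ncard : ℝ) ≤ {γ | γ ∈ Q s ∧ q γ ∈ W}.ncard +
          {γ | (s - D ≤ ‖p γ‖ ∧ ‖p γ‖ < s + D) ∧ q γ ∈ closure W}.ncard := by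
        exact_mod_cast (Set.ncard_le_ncard hsub (hQf.union hann)).trans (Set.ncard_union_le _ _)
      calc _ ≤ _ := div_le_div_of_nonneg_right hcard hs0.le
        _ = _ := add_div _ _ _
        _ ≤ _ := by gcongr
    · filter_upwards [hApos] with s hs0
      have hfin : {γ | ‖p γ‖ < s ∧ q γ ∈ W}.Finite :=
        (hpq.finite_ball hc s).subset fun γ hγ => ⟨hγ.1, subset_closure hγ.2⟩
      have hsub : {γ | γ ∈ Q s ∧ q γ ∈ W} ⊆ {γ | ‖p γ‖ < s ∧ q γ ∈ W} :=
        fun γ hγ => ⟨hQ₂ s hγ.1, hγ.2⟩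
      exact div_le_div_of_nonneg_right (by exact_mod_cast Set.ncard_le_ncard hsub hfin) hs0.le
  have hfac : (Measure.addHaarScalarFactor ν μ : ℝ) ≠ 0 := by
    exact_mod_cast (Measure.addHaarScalarFactor_pos_of_isAddHaarMeasure ν μ).ne'
  have hμ₀ : μ.real W₀ ≠ 0 := ENNReal.toReal_ne_zero.2
    ⟨hne, ((measure_mono subset_closure).trans_lt hc₀.measure_lt_top).ne⟩
  have hν₀ : ν.real W₀ ≠ 0 := by
    rw [hreal hc₀]
    exact mul_ne_zero hfac hμ₀
  have hlim2 := (key hc hW).div (key hc₀ hW₀) hν₀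
  rw [hreal hc, hreal hc₀, mul_div_mul_left _ _ hfac] at hlim2
  refine hlim2.congr' ?_
  filter_upwards [hApos] with s hs
  exact div_div_div_cancel_right₀ hs.ne' _ _

end Density

/-! ### Counting images in internal space -/

section Reduction

/-- A group that spans a finite-dimensional space is relatively dense in it: round down the
coefficients with respect to finitely many spanning elements. -/
theorem exists_bound_near_of_mem_span {E : Type*} [NormedAddCommGroup E] [NormedSpace ℝ E]
    [FiniteDimensional ℝ E] (Z : AddSubgroup E) :
    ∃ D : ℝ, 0 ≤ D ∧ ∀ v ∈ Submodule.span ℝ (Z : Set E), ∃ z ∈ Z, ‖v - z‖ ≤ D := by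
  obtain ⟨t, htZ, ht⟩ := Submodule.fg_span_iff_fg_span_finset_subset (R := ℝ) (Z : Set E) |>.1
    (IsNoetherian.noetherian _)
  refine ⟨∑ b ∈ t, ‖b‖, by positivity, fun v hv => ?_⟩
  rw [ht, Submodule.mem_span_finset] at hv
  obtain ⟨c, -, rfl⟩ := hv
  refine ⟨∑ b ∈ t, ⌊c b⌋ • b, AddSubgroup.sum_mem _ fun b hb => AddSubgroup.zsmul_mem _ (htZ hb) _,
    ?_⟩
  rw [← Finset.sum_sub_distrib]
  refine (norm_sum_le _ _).trans (Finset.sum_le_sum fun b _ => ?_)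
  rw [← Int.cast_smul_eq_zsmul ℝ, ← sub_smul, norm_smul, Int.self_sub_floor, Real.norm_eq_abs,
    abs_of_nonneg (Int.fract_nonneg _)]
  exact mul_le_of_le_one_left (norm_nonneg _) (Int.fract_lt_one _).le

variable {ι E H : Type*} [AddCommGroup ι] [NormedAddCommGroup E] [InnerProductSpace ℝ E]
  [FiniteDimensional ℝ E] [AddCommGroup H]

/-- The real span of the periods, the elements `p γ` with `q γ = 0`. -/
def periodSpan (p : ι →+ E) (q : ι →+ H) : Submodule ℝ E :=
  Submodule.span ℝ (q.ker.map p : Set E)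

/-- The orthogonal projection to the complement of the span of the periods. -/
noncomputable def transverseProj (p : ι →+ E) (q : ι →+ H) : E →L[ℝ] (periodSpan p q)ᗮ :=
  (periodSpan p q)ᗮ.orthogonalProjectionOnto

/-- The homomorphism to `(periodSpan p q)ᗮ × H` that projects the physical part along the periods.
Its kernel is the kernel of `q`, so that on its range the projection to `H` is injective. -/
noncomputable def reducedHom (p : ι →+ E) (q : ι →+ H) : ι →+ (periodSpan p q)ᗮ × H :=
  (((transverseProj p q : E →ₗ[ℝ] _).toAddMonoidHom).comp p).prod q

variable {p : ι →+ E} {q : ι →+ H}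

theorem transverseProj_eq_zero {v : E} (hv : v ∈ periodSpan p q) : transverseProj p q v = 0 := by
  rw [transverseProj, Submodule.orthogonalProjectionOnto_eq_zero_iff]
  simpa using hv

theorem norm_transverseProj_le (x : E) : ‖transverseProj p q x‖ ≤ ‖x‖ :=
  Submodule.norm_orthogonalProjectionOnto_apply_le _ _

theorem reducedHom_add_of_mem_ker (γ : ι) {ζ : ι} (hζ : ζ ∈ q.ker) :
    reducedHom p q (γ + ζ) = reducedHom p q γ := by
  have h1 : transverseProj p q (p ζ) = 0 := transverseProj_eq_zero
    (Submodule.subset_span (AddSubgroup.mem_map_of_mem p hζ))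
  have h2 : q ζ = 0 := hζ
  ext1 <;> simp [reducedHom, h1, h2]

/-- The part of `p γ` along the periods is bounded by a constant after adding a suitable
period. -/
theorem exists_norm_add_le_norm_transverseProj (p : ι →+ E) (q : ι →+ H) :
    ∃ D : ℝ, 0 ≤ D ∧ ∀ γ, ∃ ζ ∈ q.ker, ‖p (γ + ζ)‖ ≤ ‖transverseProj p q (p γ)‖ + D := by
  obtain ⟨D, hD, h⟩ := exists_bound_near_of_mem_span (q.ker.map p)
  refine ⟨D, hD, fun γ => ?_⟩
  have hv : p γ - transverseProj p q (p γ) ∈ periodSpan p q := by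
    have := Submodule.sub_starProjection_mem_orthogonal (K := (periodSpan p q)ᗮ) (p γ)
    rwa [Submodule.orthogonal_orthogonal] at this
  obtain ⟨z, ⟨ζ, hζ, rfl⟩, hz⟩ := h _ hv
  refine ⟨-ζ, neg_mem hζ, ?_⟩
  have e : p (γ + -ζ) = (transverseProj p q (p γ) : E) +
      (p γ - transverseProj p q (p γ) - p ζ) := by
    rw [map_add, map_neg]; abel
  rw [e]
  exact (norm_add_le _ _).trans (add_le_add le_rfl hz)

theorem injective_snd_range_reducedHom (p : ι →+ E) (q : ι →+ H) :
    Function.Injective ((AddMonoidHom.snd _ _).comp (reducedHom p q).range.subtype) := by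
  rintro ⟨_, γ, rfl⟩ ⟨_, δ, rfl⟩ h
  have h1 : γ - δ ∈ q.ker := by
    have h2 : q γ = q δ := h
    rw [AddMonoidHom.mem_ker, map_sub, h2, sub_self]
  have h3 := reducedHom_add_of_mem_ker (p := p) δ h1
  rw [add_sub_cancel] at h3
  exact Subtype.ext h3

variable [TopologicalSpace H]

/-- Dividing out the periods yields a pair of projections of the same kind, in which the projection
to internal space is injective. -/
theorem IsCutProject.reduced (hpq : IsCutProject p q) :
    IsCutProject ((AddMonoidHom.fst _ _).comp (reducedHom p q).range.subtype)
      ((AddMonoidHom.snd _ _).comp (reducedHom p q).range.subtype) where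
  finite_slab R K hK := by
    obtain ⟨D, hD, h⟩ := exists_norm_add_le_norm_transverseProj p q
    refine ((hpq.finite_slab (R + D) hK).image (reducedHom p q).rangeRestrict).subset ?_
    rintro ⟨_, γ, rfl⟩ ⟨hγ, hγK⟩
    obtain ⟨ζ, hζ, hle⟩ := h γ
    refine ⟨γ + ζ, ⟨hle.trans (add_le_add hγ le_rfl), ?_⟩,
      Subtype.ext (reducedHom_add_of_mem_ker γ hζ)⟩
    have h2 : q ζ = 0 := hζ
    rw [map_add, h2, add_zero]
    exact hγK
  exists_near := by
    obtain ⟨R, K, hK, h⟩ := hpq.exists_near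
    refine ⟨R, K, hK, fun e => ?_⟩
    obtain ⟨γ, hγ, hγK⟩ := h e
    refine ⟨(reducedHom p q).rangeRestrict γ, ?_, hγK⟩
    have he : transverseProj p q e = e := Submodule.orthogonalProjectionOnto_mem_subspace_eq_self e
    have h1 : dist (transverseProj p q (p γ)) (transverseProj p q e) ≤ dist (p γ) e := by
      rw [dist_eq_norm, dist_eq_norm, ← map_sub]
      exact norm_transverseProj_le _
    rw [he] at h1
    exact h1.trans hγ
  denseRange := by
    refine Dense.mono ?_ hpq.denseRange
    rintro _ ⟨γ, rfl⟩
    exact ⟨(reducedHom p q).rangeRestrict γ, rfl⟩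

/-- When `q` is not injective, counting values `q γ` differs from counting elements `γ`. The values
correspond to the elements of the range of `reducedHom`, and the image of a ball in this range
agrees with a ball up to a shell of bounded width. -/
theorem IsCutProject.tendsto_ncard_image_div_ncard_image [IsTopologicalAddGroup H]
    [LocallyCompactSpace H] [T2Space H] [MeasurableSpace H] [BorelSpace H] (μ : Measure H)
    [μ.IsAddHaarMeasure] (hpq : IsCutProject p q) {W W₀ : Set H} (hc : IsCompact (closure W))
    (hW : μ (frontier W) = 0) (hc₀ : IsCompact (closure W₀)) (hW₀ : μ (frontier W₀) = 0)
    (hne : μ W₀ ≠ 0) :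
    Tendsto (fun s => ((q '' {γ | ‖p γ‖ < s ∧ q γ ∈ W}).ncard : ℝ) /
      ((q '' {γ | ‖p γ‖ < s ∧ q γ ∈ W₀}).ncard : ℝ)) atTop (𝓝 (μ.real W / μ.real W₀)) := by
  obtain ⟨D, hD, h⟩ := exists_norm_add_le_norm_transverseProj p q
  let Q : ℝ → Set (reducedHom p q).range := fun s =>
    (reducedHom p q).rangeRestrict '' {γ | ‖p γ‖ < s}
  have hQ (W : Set H) (s : ℝ) : (q '' {γ | ‖p γ‖ < s ∧ q γ ∈ W}).ncard =
      {γ | γ ∈ Q s ∧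
        ((AddMonoidHom.snd _ _).comp (reducedHom p q).range.subtype) γ ∈ W}.ncard := by
    rw [← Set.ncard_image_of_injective _ (injective_snd_range_reducedHom p q)]
    congr 1
    ext u
    constructor
    · rintro ⟨γ, ⟨hγ, hγW⟩, rfl⟩
      exact ⟨_, ⟨⟨γ, hγ, rfl⟩, hγW⟩, rfl⟩
    · rintro ⟨_, ⟨⟨γ, hγ, rfl⟩, hγW⟩, rfl⟩
      exact ⟨γ, ⟨hγ, hγW⟩, rfl⟩
  simp only [hQ]
  refine hpq.reduced.tendsto_ncard_div_ncard μ hD ?_ ?_ hc hW hc₀ hW₀ hne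
  · rintro s ⟨_, γ, rfl⟩ hγ
    obtain ⟨ζ, hζ, hle⟩ := h γ
    refine ⟨γ + ζ, ?_, Subtype.ext (reducedHom_add_of_mem_ker γ hζ)⟩
    have h1 : ‖transverseProj p q (p γ)‖ < s - D := hγ
    exact hle.trans_lt (by linarith)
  · rintro s _ ⟨γ, hγ, rfl⟩
    exact (norm_transverseProj_le (p γ)).trans_lt hγ

end Reduction

/-! ### The lattice of a cut and project scheme -/

section Scheme

open Metric

/-- A cocompact subgroup of a locally compact group has a compact set of representatives. -/
theorem exists_isCompact_forall_sub_mem {G : Type*} [AddCommGroup G] [TopologicalSpace G]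
    [IsTopologicalAddGroup G] [LocallyCompactSpace G] (Γ : AddSubgroup G) [CompactSpace (G ⧸ Γ)] :
    ∃ C : Set G, IsCompact C ∧ ∀ g : G, ∃ c ∈ C, g - c ∈ Γ := by
  choose N hN hNx using fun x : G => exists_compact_mem_nhds x
  have hopen (x : G) : IsOpen ((QuotientAddGroup.mk : G → G ⧸ Γ) '' interior (N x)) :=
    QuotientAddGroup.isOpenMap_coe _ isOpen_interior
  obtain ⟨F, hF⟩ := isCompact_univ.elim_finite_subcover _ hopen fun y _ => by
    obtain ⟨x, rfl⟩ := QuotientAddGroup.mk_surjective y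
    exact Set.mem_iUnion.2 ⟨x, x, mem_interior_iff_mem_nhds.2 (hNx x), rfl⟩
  refine ⟨⋃ x ∈ F, N x, F.isCompact_biUnion fun x _ => hN x, fun g => ?_⟩
  obtain ⟨x, hx, c, hc, hcg⟩ := Set.mem_iUnion₂.1 (hF (Set.mem_univ (g : G ⧸ Γ)))
  refine ⟨c, Set.mem_biUnion hx (interior_subset hc), ?_⟩
  rw [QuotientAddGroup.eq] at hcg
  rwa [sub_eq_neg_add]

variable {d : ℕ} {H : Type*} [AddCommGroup H] [TopologicalSpace H]
  [IsTopologicalAddGroup H] [LocallyCompactSpace H] [T2Space H]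

namespace CutAndProjectScheme

/-- The projection of the lattice to physical space. -/
def toPhysical (S : CutAndProjectScheme d H) : S.lattice →+ EuclideanSpace ℝ (Fin d) :=
  (AddMonoidHom.fst _ _).comp S.lattice.subtype

/-- The projection of the lattice to internal space. -/
def toInternal (S : CutAndProjectScheme d H) : S.lattice →+ H :=
  (AddMonoidHom.snd _ _).comp S.lattice.subtype

theorem isCutProject (S : CutAndProjectScheme d H) : IsCutProject S.toPhysical S.toInternal where
  finite_slab R K hK := by
    have hdisc : IsDiscrete (S.lattice : Set (EuclideanSpace ℝ (Fin d) × H)) := ⟨S.discrete⟩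
    have h1 := (AddSubgroup.tendsto_coe_cofinite_of_discrete S.lattice hdisc).eventually
      ((isCompact_closedBall (0 : EuclideanSpace ℝ (Fin d)) R).prod hK).compl_mem_cocompact
    refine Set.Finite.subset h1 fun γ hγ => ?_
    simpa [toPhysical, toInternal] using hγ
  exists_near := by
    have := S.cocompact
    obtain ⟨C, hC, h⟩ := exists_isCompact_forall_sub_mem S.lattice
    obtain ⟨R, hR⟩ := (hC.image continuous_fst).isBounded.exists_norm_le
    refine ⟨R, -(Prod.snd '' C), (hC.image continuous_snd).neg, fun e => ?_⟩
    obtain ⟨c, hc, hmem⟩ := h (e, 0)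
    refine ⟨⟨_, hmem⟩, ?_, ?_⟩
    · simpa [toPhysical, dist_eq_norm] using hR _ ⟨c, hc, rfl⟩
    · simpa [toInternal] using ⟨_, hc⟩
  denseRange := by
    refine S.dense_snd.mono ?_
    rintro _ ⟨γ, hγ, rfl⟩
    exact ⟨⟨γ, hγ⟩, rfl⟩

end CutAndProjectScheme

end Scheme

/-! ### Double counting of shells -/

section Shelling

/-- Counting the pairs `(x, x + y)` at distance `r` by the difference `y` instead of by the
centre `x`. -/
theorem shellingAverage_eq_sum {E : Type*} [NormedAddCommGroup E] {Λ : Set E} {r s : ℝ}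
    (hs : (ballPart Λ s).Finite) (hr : {y | y ∈ Λ - Λ ∧ ‖y‖ = r}.Finite) :
    shellingAverage Λ r s = ∑ y ∈ hr.toFinset,
      (({x | x ∈ ballPart Λ s ∧ x + y ∈ Λ} : Set E).ncard : ℝ) / ((ballPart Λ s).ncard : ℝ) := by
  classical
  have h1 : ∀ x ∈ hs.toFinset, (({z | z ∈ Λ ∧ dist x z = r} : Set E).ncard : ℝ) =
      ∑ y ∈ hr.toFinset, if x + y ∈ Λ then 1 else 0 := by
    intro x hx
    have hxΛ : x ∈ Λ := ((Set.Finite.mem_toFinset hs).1 hx).1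
    have e : {z | z ∈ Λ ∧ dist x z = r} =
        (fun y => x + y) '' ({y ∈ hr.toFinset | x + y ∈ Λ} : Finset E) := by
      ext z
      simp only [Finset.coe_filter, Set.Finite.mem_toFinset, Set.mem_image, Set.mem_ofPred_eq]
      constructor
      · rintro ⟨hz, hd⟩
        refine ⟨z - x, ⟨⟨Set.sub_mem_sub hz hxΛ, ?_⟩, by simpa using hz⟩, by simp⟩
        rw [← dist_eq_norm, dist_comm, hd]
      · rintro ⟨y, ⟨⟨-, hy⟩, hxy⟩, rfl⟩
        exact ⟨hxy, by simpa using hy⟩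
    rw [e, Set.ncard_image_of_injective _ (add_right_injective x), Set.ncard_coe_finset,
      Finset.sum_boole]
  have h2 : ∀ y ∈ hr.toFinset, (({x | x ∈ ballPart Λ s ∧ x + y ∈ Λ} : Set E).ncard : ℝ) =
      ∑ x ∈ hs.toFinset, if x + y ∈ Λ then 1 else 0 := by
    intro y _
    rw [Finset.sum_boole, ← Set.ncard_coe_finset]
    congr 2
    ext x
    simp
  rw [shellingAverage, finsum_mem_eq_finite_toFinset_sum _ hs, ← Finset.sum_div,
    Finset.sum_congr rfl h1, Finset.sum_congr rfl h2, Finset.sum_comm, one_div_mul_eq_div]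

end Shelling

/-! ### The overlap of a window and its translate -/

section Overlap

variable {H : Type*} [AddCommGroup H]

theorem overlapIntegrand_eq_indicator (Ω : Set H) (v : H) :
    overlapIntegrand Ω v = (Ω ∩ (· + v) ⁻¹' Ω).indicator 1 := by
  ext u
  by_cases h1 : u ∈ Ω <;> by_cases h2 : u + v ∈ Ω <;> simp [overlapIntegrand, h1, h2]

theorem IsRegularWindow.measure_ne_zero {X : Type*} [TopologicalSpace X] [MeasurableSpace X]
    {μ : Measure X} {Ω : Set X} [μ.IsOpenPosMeasure] (hΩ : IsRegularWindow μ Ω) :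
    μ Ω ≠ 0 := fun h =>
  (isOpen_interior.measure_pos μ hΩ.nonempty_interior).ne' (measure_mono_null interior_subset h)

variable [TopologicalSpace H] [MeasurableSpace H] {μ : Measure H} {Ω : Set H}

theorem IsRegularWindow.isCompact_closure_overlap (hΩ : IsRegularWindow μ Ω) (v : H) :
    IsCompact (closure (Ω ∩ (· + v) ⁻¹' Ω)) :=
  hΩ.isCompact_closure.of_isClosed_subset isClosed_closure (closure_mono Set.inter_subset_left)

variable [IsTopologicalAddGroup H] [BorelSpace H]

theorem IsRegularWindow.measure_frontier_overlap [μ.IsAddLeftInvariant]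
    (hΩ : IsRegularWindow μ Ω) (v : H) : μ (frontier (Ω ∩ (· + v) ⁻¹' Ω)) = 0 := by
  refine measure_mono_null (frontier_inter_subset _ _) (measure_union_null ?_ ?_)
  · exact measure_mono_null Set.inter_subset_left hΩ.measure_frontier
  · refine measure_mono_null Set.inter_subset_right ?_
    have h1 : frontier ((· + v) ⁻¹' Ω) = (· + v) ⁻¹' frontier Ω :=
      ((Homeomorph.addRight v).preimage_frontier Ω).symm
    rw [h1, measure_preimage_add_right]
    exact hΩ.measure_frontier

variable [μ.IsAddHaarMeasure]

theorem IsRegularWindow.integrable_overlapIntegrand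
    (hΩ : IsRegularWindow μ Ω) (v : H) : Integrable (overlapIntegrand Ω v) μ := by
  rw [overlapIntegrand_eq_indicator]
  have hfin : μ (Ω ∩ (· + v) ⁻¹' Ω) ≠ ⊤ :=
    ((measure_mono subset_closure).trans_lt (hΩ.isCompact_closure_overlap v).measure_lt_top).ne
  exact (integrableOn_const hfin (C := (1 : ℝ))).integrable_indicator₀
    (nullMeasurableSet_of_null_frontier (hΩ.measure_frontier_overlap v))

theorem IsRegularWindow.windowOverlap_eq (hΩ : IsRegularWindow μ Ω) (v : H) :
    windowOverlap μ Ω v = μ.real (Ω ∩ (· + v) ⁻¹' Ω) / μ.real Ω := by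
  rw [windowOverlap, overlapIntegrand_eq_indicator, one_div_mul_eq_div, integral_indicator₀
    (nullMeasurableSet_of_null_frontier (hΩ.measure_frontier_overlap v))]
  simp

end Overlap

/-! ### Model sets as projections of lattice points -/

namespace CutAndProjectScheme

variable {d : ℕ} {H : Type*} [AddCommGroup H] [TopologicalSpace H]
  [IsTopologicalAddGroup H] [LocallyCompactSpace H] [T2Space H] (S : CutAndProjectScheme d H)

theorem toPhysical_injective : Function.Injective S.toPhysical := fun γ δ h =>
  Subtype.ext (S.injOn_fst γ.2 δ.2 h)

theorem starMap_toPhysical (γ : S.lattice) : S.starMap (S.toPhysical γ) = S.toInternal γ :=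
  S.starMap_eq γ.2

theorem mem_modelSet {Ω : Set H} {x : EuclideanSpace ℝ (Fin d)} :
    x ∈ S.modelSet Ω ↔ ∃ γ, S.toPhysical γ = x ∧ S.toInternal γ ∈ Ω := by
  constructor
  · rintro ⟨⟨γ, hγ, rfl⟩, h⟩
    refine ⟨⟨γ, hγ⟩, rfl, ?_⟩
    rwa [← S.starMap_toPhysical]
  · rintro ⟨γ, rfl, h⟩
    exact ⟨⟨γ, γ.2, rfl⟩, by rwa [S.starMap_toPhysical]⟩

theorem toPhysical_mem_modelSet {Ω : Set H} {γ : S.lattice} :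
    S.toPhysical γ ∈ S.modelSet Ω ↔ S.toInternal γ ∈ Ω := by
  rw [mem_modelSet]
  exact ⟨fun ⟨δ, h, hδ⟩ => S.toPhysical_injective h ▸ hδ, fun h => ⟨γ, rfl, h⟩⟩

theorem ballPart_modelSet (Ω : Set H) (s : ℝ) : ballPart (S.modelSet Ω) s =
    S.toPhysical '' {γ | ‖S.toPhysical γ‖ < s ∧ S.toInternal γ ∈ Ω} := by
  ext x
  constructor
  · rintro ⟨hx, hs⟩
    obtain ⟨γ, rfl, hγ⟩ := S.mem_modelSet.1 hx
    exact ⟨γ, ⟨by simpa using hs, hγ⟩, rfl⟩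
  · rintro ⟨γ, ⟨hs, hγ⟩, rfl⟩
    exact ⟨S.toPhysical_mem_modelSet.2 hγ, by simpa using hs⟩

theorem starMap_image_toPhysical_image (T : Set S.lattice) :
    S.starMap '' (S.toPhysical '' T) = S.toInternal '' T := by
  rw [Set.image_image]
  simp only [starMap_toPhysical]

theorem setOf_ballPart_add_mem (Ω : Set H) (s : ℝ) (τ : S.lattice) :
    {x | x ∈ ballPart (S.modelSet Ω) s ∧ x + S.toPhysical τ ∈ S.modelSet Ω} =
      S.toPhysical '' {γ | ‖S.toPhysical γ‖ < s ∧
        S.toInternal γ ∈ Ω ∩ (· + S.toInternal τ) ⁻¹' Ω} := by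
  rw [ballPart_modelSet]
  ext x
  constructor
  · rintro ⟨⟨γ, ⟨hs, hγ⟩, rfl⟩, h⟩
    rw [← map_add, toPhysical_mem_modelSet, map_add] at h
    exact ⟨γ, ⟨hs, hγ, h⟩, rfl⟩
  · rintro ⟨γ, ⟨hs, hγ, h⟩, rfl⟩
    refine ⟨⟨γ, ⟨hs, hγ⟩, rfl⟩, ?_⟩
    rw [← map_add, toPhysical_mem_modelSet, map_add]
    exact h

theorem setOf_ballPart_starMap_add_mem (Ω : Set H) (s : ℝ) (τ : S.lattice) :
    {x | x ∈ ballPart (S.modelSet Ω) s ∧ S.starMap (x + S.toPhysical τ) ∈ Ω} =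
      S.toPhysical '' {γ | ‖S.toPhysical γ‖ < s ∧
        S.toInternal γ ∈ Ω ∩ (· + S.toInternal τ) ⁻¹' Ω} := by
  rw [← setOf_ballPart_add_mem, ballPart_modelSet]
  ext x
  refine and_congr_right ?_
  rintro ⟨γ, -, rfl⟩
  rw [← map_add, toPhysical_mem_modelSet, starMap_toPhysical]

theorem finite_modelSet_sub_inter_sphere {Ω : Set H} (hΩ : IsCompact (closure Ω)) (r : ℝ) :
    {y | y ∈ S.modelSet Ω - S.modelSet Ω ∧ ‖y‖ = r}.Finite := by
  refine ((S.isCutProject.finite_slab r (isCompact_sub hΩ hΩ)).image S.toPhysical).subset ?_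
  rintro _ ⟨⟨x, hx, z, hz, rfl⟩, hr⟩
  obtain ⟨γ, rfl, hγ⟩ := S.mem_modelSet.1 hx
  obtain ⟨δ, rfl, hδ⟩ := S.mem_modelSet.1 hz
  refine ⟨γ - δ, ⟨?_, ?_⟩, map_sub _ _ _⟩
  · rw [map_sub]; exact hr.le
  · rw [map_sub]
    exact Set.sub_mem_sub (subset_closure hγ) (subset_closure hδ)

theorem exists_toPhysical_eq_of_mem_sub {Ω : Set H} {y : EuclideanSpace ℝ (Fin d)}
    (hy : y ∈ S.modelSet Ω - S.modelSet Ω) : ∃ τ, S.toPhysical τ = y := by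
  obtain ⟨x, hx, z, hz, rfl⟩ := hy
  obtain ⟨γ, rfl, -⟩ := S.mem_modelSet.1 hx
  obtain ⟨δ, rfl, -⟩ := S.mem_modelSet.1 hz
  exact ⟨γ - δ, map_sub _ _ _⟩

variable [MeasurableSpace H] [BorelSpace H] {μ : Measure H} [μ.IsAddHaarMeasure] {Ω : Set H}

theorem hasAutocorrelation (hΩ : IsRegularWindow μ Ω) (τ : S.lattice) :
    HasAutocorrelation (S.modelSet Ω) (S.toPhysical τ)
      (windowOverlap μ Ω (S.toInternal τ)) := by
  rw [HasAutocorrelation, hΩ.windowOverlap_eq]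
  simp only [setOf_ballPart_add_mem]
  simp only [ballPart_modelSet, Set.ncard_image_of_injective _ S.toPhysical_injective]
  exact S.isCutProject.tendsto_ncard_div_ncard μ le_rfl
    (Q := fun s => {γ | ‖S.toPhysical γ‖ < s}) (fun s => by simp) (fun s => le_rfl)
    (hΩ.isCompact_closure_overlap _) (hΩ.measure_frontier_overlap _) hΩ.isCompact_closure
    hΩ.measure_frontier hΩ.measure_ne_zero

theorem hasInternalAutocorrelation (hΩ : IsRegularWindow μ Ω) (τ : S.lattice) :
    HasInternalAutocorrelation S Ω (S.toPhysical τ) (windowOverlap μ Ω (S.toInternal τ)) := by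
  rw [HasInternalAutocorrelation, hΩ.windowOverlap_eq]
  simp only [setOf_ballPart_starMap_add_mem]
  simp only [ballPart_modelSet, starMap_image_toPhysical_image]
  exact S.isCutProject.tendsto_ncard_image_div_ncard_image μ
    (hΩ.isCompact_closure_overlap _) (hΩ.measure_frontier_overlap _) hΩ.isCompact_closure
    hΩ.measure_frontier hΩ.measure_ne_zero

end CutAndProjectScheme

theorem mainTheorem1 (d : ℕ) {H : Type*} [AddCommGroup H] [TopologicalSpace H]
    [IsTopologicalAddGroup H] [LocallyCompactSpace H] [T2Space H]
    [MeasurableSpace H] [BorelSpace H] (μ : Measure H) [μ.IsAddHaarMeasure]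
    (S : CutAndProjectScheme d H) (Ω : Set H) (hΩ : IsRegularWindow μ Ω) :
    0 < μ.real Ω ∧
    (∀ s : ℝ, (ballPart (S.modelSet Ω) s).Finite) ∧
    (∀ y ∈ S.modelSet Ω - S.modelSet Ω,
      Integrable (overlapIntegrand Ω (S.starMap y)) μ ∧
      HasAutocorrelation (S.modelSet Ω) y (windowOverlap μ Ω (S.starMap y)) ∧
      HasInternalAutocorrelation S Ω y (windowOverlap μ Ω (S.starMap y))) ∧
    (∀ r : ℝ,
      {y | y ∈ S.modelSet Ω - S.modelSet Ω ∧ ‖y‖ = r}.Finite ∧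
      HasAveragedShelling (S.modelSet Ω) r
        (∑ᶠ y ∈ {y | y ∈ S.modelSet Ω - S.modelSet Ω ∧ ‖y‖ = r},
          windowOverlap μ Ω (S.starMap y))) := by
  have hauto : ∀ y ∈ S.modelSet Ω - S.modelSet Ω,
      HasAutocorrelation (S.modelSet Ω) y (windowOverlap μ Ω (S.starMap y)) := fun y hy => by
    obtain ⟨τ, rfl⟩ := S.exists_toPhysical_eq_of_mem_sub hy
    rw [S.starMap_toPhysical]
    exact S.hasAutocorrelation hΩ τ
  have hball (s : ℝ) : (ballPart (S.modelSet Ω) s).Finite := by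
    rw [S.ballPart_modelSet]
    exact ((S.isCutProject.finite_ball hΩ.isCompact_closure s).subset fun γ hγ =>
      ⟨hγ.1, subset_closure hγ.2⟩).image _
  refine ⟨ENNReal.toReal_pos hΩ.measure_ne_zero
    ((measure_mono subset_closure).trans_lt hΩ.isCompact_closure.measure_lt_top).ne, hball,
    fun y hy => ⟨hΩ.integrable_overlapIntegrand _, hauto y hy, ?_⟩, fun r => ?_⟩
  · obtain ⟨τ, rfl⟩ := S.exists_toPhysical_eq_of_mem_sub hy
    rw [S.starMap_toPhysical]
    exact S.hasInternalAutocorrelation hΩ τ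
  · have hr := S.finite_modelSet_sub_inter_sphere hΩ.isCompact_closure r
    refine ⟨hr, ?_⟩
    rw [HasAveragedShelling, finsum_mem_eq_finite_toFinset_sum _ hr]
    exact (tendsto_finsetSum _ fun y hy => hauto y ((Set.Finite.mem_toFinset hr).1 hy).1).congr
      fun s => (shellingAverage_eq_sum (hball s) hr).symm
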